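/- Let $0<\rho<1$, $\alpha\in\mathbb R$, let $h_0\le h_1\le h_2\le\cdots$ be non-negative integers, $\xi\in\mathbb C$ (in particular $\xi=\mathrm{sn}^2(\zeta,\rho)$), and put $\eta=(1+\rho^2)\xi$, $z=-\rho^2\xi^2$. The type-2 Lamé polynomial of the first kind (with $h_j$ attached to the spectral values $h=4(1+\rho^2)(h_j+2j)^2$) is the sum $$LF^R_{h_j}(\xi)=\sum_{n=0}^\infty f_n(\eta)\,z^n,$$ taken wherever this series converges, where $$f_n(\eta)=\sum_{i_0=0}^{h_0}\sum_{i_1=i_0}^{h_1}\cdots\sum_{i_n=i_{n-1}}^{h_n}\ \prod_{k=0}^{n-1}\frac{(i_k+2k+\frac{\alpha}{2}+\frac12)(i_k+2k-\frac{\alpha}{2})}{(i_k+2k+2)(i_k+2k+\frac32)}\ \prod_{k=0}^{n}\frac{(-h_k)_{i_k}(h_k+4k)_{i_k}(2k+1)_{i_{k-1}}(2k+\frac12)_{i_{k-1}}}{(-h_k)_{i_{k-1}}(h_k+4k)_{i_{k-1}}(2k+1)_{i_k}(2k+\frac12)_{i_k}}\ \eta^{i_n},$$ with $i_{-1}=0$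 and $(x)_i=x(x+1)\cdots(x+i-1)$. For $m\ge1$ and a function $F$ define $$(K_mF)(w)=\int_0^1 dt\,t^{2m-1}\int_0^1du\,u^{2m-\frac32}\,\frac1{2\pi i}\oint\frac{dv}{v}\left(\frac{v-1}{v}\,\frac{1}{1-w(1-t)(1-u)v}\right)^{h_m}\bigl(1-w(1-t)(1-u)v\bigr)^{-4m}\,(D_mF)\bigl(W(w,t,u,v)\bigr),$$ $$D_m=w^{-(2m-\frac32+\frac\alpha2)}\,(w\partial_w)\,w^{\alpha+\frac12}\,(w\partial_w)\,w^{2m-2-\frac\alpha2},\qquad W(w,t,u,v)=\frac{v}{v-1}\,\frac{w\,t\,u}{1-wv(1-t)(1-u)},$$ where the powers of $w$ in $D_m$ are taken with one branch of $\log w$ near the point $w\neq0$ considered, and $v$ runs once counterclockwise around a circle centred at $0$ that does not pass through $1$ and leaves the point $1/(w(1-t)(1-u))$ outside. The radius of the circle may be chosen arbitrarily subject to this, depending on $m,w,t,u$. For $n\ge 0$ put $$I_n=K_nK_{n-1}\cdots K_1\ {}_2F_1\bigl(-h_0,h_0;\tfrac12;\cdot\bigr);$$ that is, $I_n(\eta)$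 is the iterated integral over $t_n,u_n,v_n,\dots,t_1,u_1,v_1$ with $w_{n+1,n}=\eta$, $w_{m,n}=W(w_{m+1,n},t_m,u_m,v_m)$, ending in ${}_2F_1(-h_0,h_0;\frac12;w_{1,n})$. Then, for every such choice of radii, all these integrals converge absolutely, $f_0(\eta)={}_2F_1(-h_0,h_0;\frac12;\eta)$, $f_n(\eta)z^n=I_n(\eta)z^n$ for all $n\ge1$, and consequently $$LF^R_{h_j}(\xi)={}_2F_1\bigl(-h_0,h_0;\tfrac12;\eta\bigr)+\sum_{n=1}^\infty I_n(\eta)\,z^n ,$$ in the sense that either side converges if and only if the other does, and then to the same value. -/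

import Mathlib

open Filter Topology MeasureTheory

namespace Lame

noncomputable section

/-! ### The power series defining the type-2 function of the first kind -/

/-- The Pochhammer symbol `(x)_i = x (x + 1) ⋯ (x + i - 1)`. -/
def poch (x : ℂ) (i : ℕ) : ℂ := (ascPochhammer ℂ i).eval x

/-- The quotient
`(-h_k)_i (h_k+4k)_i (2k+1)_p (2k+1/2)_p / ((-h_k)_p (h_k+4k)_p (2k+1)_i (2k+1/2)_i)`.
For `k = 0`, `p = 0` it is `(-h_0)_i (h_0)_i / ((1)_i (1/2)_i)`. -/
def stepCoeff (h : ℕ → ℕ) (k p i : ℕ) : ℂ :=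
  (poch (-(h k : ℂ)) i * poch ((h k : ℂ) + 4 * k) i
      * poch (2 * k + 1) p * poch (2 * k + 1 / 2) p) /
    (poch (-(h k : ℂ)) p * poch ((h k : ℂ) + 4 * k) p
      * poch (2 * k + 1) i * poch (2 * k + 1 / 2) i)

/-- The factor `(i+2k+α/2+1/2)(i+2k-α/2) / ((i+2k+2)(i+2k+3/2))`. -/
def jumpCoeff (α : ℝ) (k i : ℕ) : ℂ :=
  (((i : ℂ) + 2 * k + α / 2 + 1 / 2) * ((i : ℂ) + 2 * k - α / 2)) /
    (((i : ℂ) + 2 * k + 2) * ((i : ℂ) + 2 * k + 3 / 2))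

/-- The nested sums over `i_k, i_{k+1}, …, i_{k+r}`, where `p = i_{k-1}`:
`∑_{i_k = p}^{h_k} ⋯ ∑_{i_{k+r} = i_{k+r-1}}^{h_{k+r}}` of the product of the step coefficients,
of the jump coefficients of all indices but the last one, and of `η ^ i_{k+r}`. -/
def nestedSum (α : ℝ) (h : ℕ → ℕ) (η : ℂ) : (r k p : ℕ) → ℂ
  | 0, k, p => ∑ i ∈ Finset.Icc p (h k), stepCoeff h k p i * η ^ i
  | r + 1, k, p =>
      ∑ i ∈ Finset.Icc p (h k),
        jumpCoeff α k i * stepCoeff h k p i * nestedSum α h η r (k + 1) i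

/-- The coefficient of `z ^ n` (a polynomial in `η`) in the series of the type-2 function: the sums
over `0 ≤ i_0 ≤ h_0`, `i_0 ≤ i_1 ≤ h_1`, …, `i_{n-1} ≤ i_n ≤ h_n`. -/
def seriesCoeff (α : ℝ) (h : ℕ → ℕ) (n : ℕ) (η : ℂ) : ℂ := nestedSum α h η n 0 0

/-- `η = (1 + ρ²) ξ`. -/
def etaVar (ρ : ℝ) (ξ : ℂ) : ℂ := (1 + (ρ : ℂ) ^ 2) * ξ

/-- `z = -ρ² ξ²`. -/
def zVar (ρ : ℝ) (ξ : ℂ) : ℂ := -((ρ : ℂ) ^ 2) * ξ ^ 2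

/-- `IsLF ρ α h ξ y`: the series `∑_{n ≥ 0} seriesCoeff n (η) z ^ n` which defines the type-2 Lamé
function of the first kind `LF^R_{h_j}` converges at `ξ`, and its sum `LF^R_{h_j}(ξ)` is `y`. -/
def IsLF (ρ α : ℝ) (h : ℕ → ℕ) (ξ y : ℂ) : Prop :=
  Tendsto (fun N : ℕ =>
      ∑ n ∈ Finset.range (N + 1), seriesCoeff α h n (etaVar ρ ξ) * zVar ρ ξ ^ n)
    atTop (𝓝 y)

/-! ### The iterated integrals -/

/-- The Euler operator `w ∂_w`. -/
def euler (g : ℂ → ℂ) (w : ℂ) : ℂ := w * deriv g w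

/-- For `w₀ ≠ 0`, the branch of the power function `w ↦ w ^ s` that is holomorphic near `w₀` and
takes the principal value there. -/
def branchPow (w₀ s w : ℂ) : ℂ := Complex.exp (s * (Complex.log w₀ + Complex.log (w / w₀)))

/-- `w^{-(2m-3/2+α/2)} (w ∂_w) w^{α+1/2} (w ∂_w) w^{2m-2-α/2} f`, evaluated at `w = w₀ ≠ 0`. -/
def eulerTwist (α : ℝ) (m : ℕ) (f : ℂ → ℂ) (w₀ : ℂ) : ℂ :=
  branchPow w₀ (-(2 * m - 3 / 2 + α / 2)) w₀ *
    euler (fun w => branchPow w₀ (α + 1 / 2) w *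
      euler (fun w' => branchPow w₀ (2 * m - 2 - α / 2) w' * f w') w) w₀

/-- The recursion for the variables: `w_{m,n}` as a function of
`w = w_{m+1,n}` and of `t_m, u_m, v_m`. -/
def nextW (w : ℂ) (t u : ℝ) (v : ℂ) : ℂ :=
  v / (v - 1) * (w * t * u / (1 - w * v * (1 - t) * (1 - u)))

/-- The integrand of the contour integral in `v = v_m`; here `w = w_{m+1,n}`, and the operator
acts on a function `f` of `w_{m,n}`. -/
def vIntegrand (α : ℝ) (h : ℕ → ℕ) (m : ℕ) (f : ℂ → ℂ) (w : ℂ) (t u : ℝ) (v : ℂ) : ℂ :=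
  1 / v * ((v - 1) / v * (1 / (1 - w * (1 - t) * (1 - u) * v))) ^ h m
    * (1 - w * (1 - t) * (1 - u) * v) ^ (-(4 * m : ℤ))
    * eulerTwist α m f (nextW w t u v)

/-- `R m w t u` is the radius of the circle about `0` on which `v_m` runs, when `w_{m+1,n} = w`,
`t_m = t` and `u_m = u`. The circle has to avoid `1` and to leave the singularity
`v = 1 / (w (1 - t) (1 - u))` outside. -/
def AdmissibleRadii (R : ℕ → ℂ → ℝ → ℝ → ℝ) : Prop :=
  ∀ (m : ℕ) (w : ℂ), ∀ t ∈ Set.Icc (0 : ℝ) 1, ∀ u ∈ Set.Icc (0 : ℝ) 1,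
    0 < R m w t u ∧ R m w t u ≠ 1 ∧ R m w t u * ‖w * (1 - t) * (1 - u)‖ < 1

/-- The integrand in `u = u_m`: `u^{2m-3/2} (2πi)⁻¹ ∮ ⋯ dv`. -/
def uIntegrand (α : ℝ) (h : ℕ → ℕ) (R : ℕ → ℂ → ℝ → ℝ → ℝ) (m : ℕ) (f : ℂ → ℂ)
    (w : ℂ) (t u : ℝ) : ℂ :=
  ((u ^ (2 * (m : ℝ) - 3 / 2) : ℝ) : ℂ) *
    (1 / (2 * Real.pi * Complex.I) *
      ∮ v in C(0, R m w t u), vIntegrand α h m f w t u v)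

/-- The integrand in `t = t_m`: `t^{2m-1} ∫₀¹ u^{2m-3/2} ⋯ du`. -/
def tIntegrand (α : ℝ) (h : ℕ → ℕ) (R : ℕ → ℂ → ℝ → ℝ → ℝ) (m : ℕ) (f : ℂ → ℂ)
    (w : ℂ) (t : ℝ) : ℂ :=
  ((t ^ (2 * (m : ℝ) - 1) : ℝ) : ℂ) * ∫ u in (0 : ℝ)..1, uIntegrand α h R m f w t u

/-- The `m`-th factor of the ordered product of integral operators, applied to `f` and evaluated
at `w = w_{m+1,n}`. -/
def integralOp (α : ℝ) (h : ℕ → ℕ) (R : ℕ → ℂ → ℝ → ℝ → ℝ) (m : ℕ) (f : ℂ → ℂ) (w : ℂ) : ℂ :=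
  ∫ t in (0 : ℝ)..1, tIntegrand α h R m f w t

/-- The factors `m, m-1, …, 1` (outermost first) applied to `₂F₁(-h_0, h_0; 1/2; ·)`. Its value at
`w_{n+1,n} = η` for `m = n` is the coefficient of `z ^ n` in the integral representation. -/
def iteratedIntegral (α : ℝ) (h : ℕ → ℕ) (R : ℕ → ℂ → ℝ → ℝ → ℝ) : ℕ → ℂ → ℂ
  | 0 => fun w => ordinaryHypergeometric (-(h 0 : ℂ)) (h 0 : ℂ) (1 / 2 : ℂ) w
  | m + 1 => integralOp α h R (m + 1) (iteratedIntegral α h R m)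

end

end Lame

namespace Lame

/-! Each integral operator can be computed on monomials. The twisted Euler operator is diagonal on
powers: it multiplies `w ^ p` by the numerator of the jump coefficient (`eulerTwist_eq_sum`).
Substituting `W ^ p` into the kernel cancels `p` factors of `(v - 1) / v`. Since the degrees so far
are at most the next `h`, the exponent left over is a natural number, so there is no pole at `v = 1`
(`vIntegrand_eq_sum`). The only pole inside the circle is then `v = 0`, which is why the radius does
not matter. Its residue is a finite sum over `j` of powers of `w (1 - t) (1 - u)`, and two beta
integrals in `t` and `u` turn each term into a step coefficient divided by the denominator of the
jump coefficient (`stepCoeff_succ_add`).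

So applying the operator to a polynomial appends one innermost sum (`integrals_of_eq_sum`), and
induction on `n` gives the series coefficients at every nonzero argument. At zero both expansions
contribute nothing for `n ≥ 1`, because `z` vanishes along with `η`. -/

/-! ### Pochhammer symbols -/

lemma poch_succ (x : ℂ) (i : ℕ) : poch x (i + 1) = poch x i * (x + i) :=
  ascPochhammer_succ_eval i x

lemma poch_zero (x : ℂ) : poch x 0 = 1 := by simp [poch]

lemma poch_eq_prod (x : ℂ) (i : ℕ) : poch x i = ∏ l ∈ Finset.range i, (x + l) := by
  induction i with
  | zero => simp [poch]
  | succ i ih => rw [poch_succ, Finset.prod_range_succ, ih]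

lemma poch_add (x : ℂ) (p j : ℕ) : poch x (p + j) = poch x p * poch (x + p) j := by
  rw [poch_eq_prod, poch_eq_prod, poch_eq_prod, Finset.prod_range_add]
  congr 1
  exact Finset.prod_congr rfl fun l _ => by push_cast; ring

lemma poch_succ' (x : ℂ) (i : ℕ) : poch x (i + 1) = x * poch (x + 1) i := by
  rw [add_comm, poch_add]
  simp [poch_eq_prod]

lemma poch_ne_zero_of_re_pos {x : ℂ} (hx : 0 < x.re) (i : ℕ) : poch x i ≠ 0 := by
  rw [poch_eq_prod, Finset.prod_ne_zero_iff]
  intro l _ h0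
  have := congrArg Complex.re h0
  simp at this
  have hl : (0 : ℝ) ≤ l := Nat.cast_nonneg l
  linarith

lemma poch_neg_ne_zero {N p : ℕ} (hp : p ≤ N) : poch (-(N : ℂ)) p ≠ 0 := by
  rw [poch_eq_prod, Finset.prod_ne_zero_iff]
  intro l hl h0
  rw [Finset.mem_range] at hl
  have h1 : (l : ℂ) = N := by linear_combination h0
  have h2 : l = N := by exact_mod_cast h1
  omega

lemma poch_neg_natCast {N j : ℕ} (hj : j ≤ N) :
    poch (-(N : ℂ)) j = (N.choose j : ℂ) * (-1) ^ j * j.factorial := by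
  have key : poch (-(N : ℂ)) j = (-1) ^ j * (N.descFactorial j : ℂ) := by
    induction j with
    | zero => simp [poch_zero]
    | succ j ih =>
      rw [poch_succ, ih (by omega), Nat.descFactorial_succ, Nat.cast_mul,
        Nat.cast_sub (by omega)]
      ring
  rw [key, Nat.descFactorial_eq_factorial_mul_choose]
  push_cast
  ring

lemma poch_natCast_eq_multichoose {A : ℕ} (hA : 0 < A) (j : ℕ) :
    poch (A : ℂ) j = (A.multichoose j : ℂ) * j.factorial := by
  obtain ⟨a, rfl⟩ := Nat.exists_eq_succ_of_ne_zero hA.ne'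
  have h1 : poch ((a.succ : ℕ) : ℂ) j = ((a + 1).ascFactorial j : ℂ) := by
    rw [poch, Nat.cast_ascFactorial]
  rw [h1, Nat.ascFactorial_eq_factorial_mul_choose, Nat.multichoose_eq,
    show a.succ + j - 1 = a + j by omega]
  push_cast
  ring

/-! ### Contour integrals around `v = 0` -/

lemma one_sub_mul_ne_zero {b v : ℂ} {R : ℝ} (hb : R * ‖b‖ < 1) (hv : ‖v‖ ≤ R) :
    1 - b * v ≠ 0 := by
  intro h0
  have h1 : b * v = 1 := by linear_combination -h0
  have h2 : ‖b‖ * ‖v‖ = 1 := by rw [← norm_mul, h1, norm_one]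
  nlinarith [norm_nonneg b, mul_le_mul_of_nonneg_left hv (norm_nonneg b)]

lemma continuousOn_inv_pow_mul_inv_pow {b : ℂ} {R : ℝ} (hR : 0 < R) (hb : R * ‖b‖ < 1)
    (j A : ℕ) :
    ContinuousOn (fun v : ℂ => (v ^ j)⁻¹ * ((1 - b * v) ^ A)⁻¹) (Metric.sphere 0 R) := by
  refine ContinuousOn.mul (ContinuousOn.inv₀ (by fun_prop) ?_)
    (ContinuousOn.inv₀ (by fun_prop) ?_) <;> intro v hv <;> rw [mem_sphere_zero_iff_norm] at hv
  · exact pow_ne_zero _ (norm_ne_zero_iff.mp (by rw [hv]; exact hR.ne'))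
  · exact pow_ne_zero _ (one_sub_mul_ne_zero hb hv.le)

lemma circleIntegrable_const_mul_inv_pow_mul_inv_pow {b : ℂ} {R : ℝ} (hR : 0 < R)
    (hb : R * ‖b‖ < 1) (c : ℂ) (j A : ℕ) :
    CircleIntegrable (fun v : ℂ => c * ((v ^ j)⁻¹ * ((1 - b * v) ^ A)⁻¹)) 0 R :=
  (continuousOn_const.mul (continuousOn_inv_pow_mul_inv_pow hR hb j A)).circleIntegrable hR.le

/-- The coefficients of the power series of `(1 - b v) ^ (-A)` as contour integrals. -/
lemma circleIntegral_inv_pow_mul_inv_pow {b : ℂ} {R : ℝ} (hR : 0 < R) (hb : R * ‖b‖ < 1)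
    (A j : ℕ) :
    (∮ v in C(0, R), (v ^ (j + 1))⁻¹ * ((1 - b * v) ^ A)⁻¹) =
      2 * Real.pi * Complex.I * (A.multichoose j * b ^ j) := by
  induction A generalizing j with
  | zero =>
    cases j with
    | zero => simpa using circleIntegral.integral_sub_center_inv (0 : ℂ) hR.ne'
    | succ j =>
      have h1 := circleIntegral.integral_sub_zpow_of_ne (n := -((j : ℤ) + 2)) (by omega) 0 0 R
      simp only [sub_zero, zpow_neg] at h1
      simp only [pow_zero, inv_one, mul_one, Nat.multichoose_zero_succ, Nat.cast_zero, zero_mul,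
        mul_zero]
      exact_mod_cast h1
  | succ A ihA =>
    induction j with
    | zero =>
      have hd : DiffContOnCl ℂ (fun v : ℂ => ((1 - b * v) ^ (A + 1))⁻¹) (Metric.ball 0 R) := by
        apply DifferentiableOn.diffContOnCl_ball (U := Metric.closedBall 0 R) _ subset_rfl
        intro v hv
        rw [mem_closedBall_zero_iff] at hv
        have := one_sub_mul_ne_zero hb hv
        exact DifferentiableAt.differentiableWithinAt
          (DifferentiableAt.inv (by fun_prop) (pow_ne_zero _ this))
      have := hd.circleIntegral_sub_inv_smul (w := 0) (Metric.mem_ball_self hR)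
      simpa using this
    | succ j ihj =>
      -- With `B = 1 - b v`, the identity `B⁻¹ = 1 + b v B⁻¹` mirrors Pascal's rule for
      -- `multichoose`, hence the double induction.
      have hsplit : (∮ v in C(0, R), (v ^ (j + 1 + 1))⁻¹ * ((1 - b * v) ^ (A + 1))⁻¹) =
          ∮ v in C(0, R), ((v ^ (j + 1 + 1))⁻¹ * ((1 - b * v) ^ A)⁻¹
            - (-b) * ((v ^ (j + 1))⁻¹ * ((1 - b * v) ^ (A + 1))⁻¹)) := by
        refine circleIntegral.integral_congr hR.le fun v hv => ?_
        rw [mem_sphere_zero_iff_norm] at hv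
        have h0 : v ≠ 0 := norm_ne_zero_iff.mp (by rw [hv]; exact hR.ne')
        have h1 := one_sub_mul_ne_zero hb hv.le
        rw [pow_succ _ A, pow_succ _ (j + 1)]
        generalize hB : 1 - b * v = B at h1 ⊢
        field_simp
        linear_combination hB
      rw [hsplit, circleIntegral.integral_sub
        ((continuousOn_inv_pow_mul_inv_pow hR hb _ _).circleIntegrable hR.le)
        (circleIntegrable_const_mul_inv_pow_mul_inv_pow hR hb _ _ _), circleIntegral.integral_const_mul, ihA, ihj, Nat.multichoose_succ_succ]
      push_cast
      ring

lemma div_pow_mul_eq_sum (v c : ℂ) (hv : v ≠ 0) (N : ℕ) :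
    v⁻¹ * ((v - 1) / v) ^ N * c =
      ∑ j ∈ Finset.range (N + 1), (N.choose j * (-1) ^ j : ℂ) * ((v ^ (j + 1))⁻¹ * c) := by
  have h1 : (v - 1) / v = -v⁻¹ + 1 := by field_simp; ring
  rw [h1, add_pow, Finset.mul_sum, Finset.sum_mul]
  refine Finset.sum_congr rfl fun j _ => ?_
  rw [neg_pow, inv_pow, pow_succ, mul_inv]
  ring

lemma circleIntegral_div_pow_mul_inv_pow {b : ℂ} {R : ℝ} (hR : 0 < R) (hb : R * ‖b‖ < 1)
    (N A : ℕ) :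
    (∮ v in C(0, R), v⁻¹ * ((v - 1) / v) ^ N * ((1 - b * v) ^ A)⁻¹) =
      2 * Real.pi * Complex.I * ∑ j ∈ Finset.range (N + 1),
        (N.choose j * (-1) ^ j * A.multichoose j : ℂ) * b ^ j := by
  have h1 : (∮ v in C(0, R), v⁻¹ * ((v - 1) / v) ^ N * ((1 - b * v) ^ A)⁻¹) =
      ∮ v in C(0, R), ∑ j ∈ Finset.range (N + 1),
        (N.choose j * (-1) ^ j : ℂ) * ((v ^ (j + 1))⁻¹ * ((1 - b * v) ^ A)⁻¹) := by
    refine circleIntegral.integral_congr hR.le fun v hv => div_pow_mul_eq_sum v _ ?_ N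
    rw [mem_sphere_zero_iff_norm] at hv
    exact norm_ne_zero_iff.mp (by rw [hv]; exact hR.ne')
  rw [h1, circleIntegral.integral_fun_sum fun j _ =>
    circleIntegrable_const_mul_inv_pow_mul_inv_pow hR hb _ _ _,
    Finset.mul_sum]
  refine Finset.sum_congr rfl fun j _ => ?_
  rw [circleIntegral.integral_const_mul, circleIntegral_inv_pow_mul_inv_pow hR hb]
  ring

/-! ### Beta integrals and step coefficients -/

lemma integral_rpow_mul_pow_mul_one_sub_pow (s : ℝ) (hs : 0 ≤ s) (p j : ℕ) :
    (∫ x in (0 : ℝ)..1, ((x ^ s : ℝ) : ℂ) * ((x : ℂ) ^ p * (1 - (x : ℂ)) ^ j)) =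
      j.factorial / poch (s + 1 + p) (j + 1) := by
  have hu : 0 < ((s : ℂ) + 1 + p).re := by
    simp
    positivity
  rw [poch_eq_prod, ← Complex.betaIntegral_eval_nat_add_one_right hu, Complex.betaIntegral]
  refine intervalIntegral.integral_congr_ae (ae_of_all _ fun x hx => ?_)
  rw [Set.uIoc_of_le zero_le_one] at hx
  have hx0 : (x : ℂ) ≠ 0 := by exact_mod_cast hx.1.ne'
  rw [show (s : ℂ) + 1 + p - 1 = s + p by ring, add_sub_cancel_right, Complex.cpow_add _ _ hx0,
    Complex.cpow_natCast, Complex.cpow_natCast, Complex.ofReal_cpow hx.1.le]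
  ring

/-- The product of the residue and of the two beta integrals is the step coefficient. -/
lemma stepCoeff_succ_add (h : ℕ → ℕ) (m p j : ℕ) (hj : p + j ≤ h (m + 1)) :
    ((h (m + 1) - p).choose j * (-1) ^ j * (h (m + 1) + 4 * (m + 1) + p).multichoose j : ℂ) *
      (j.factorial / poch (2 * (m + 1) + p) (j + 1)) *
      (j.factorial / poch (2 * (m + 1) - 1 / 2 + p) (j + 1)) =
    stepCoeff h (m + 1) p (p + j) / ((p + 2 * m + 2) * (p + 2 * m + 3 / 2)) := by
  set H := h (m + 1)
  have e1 := poch_neg_natCast (N := H - p) (j := j) (by omega)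
  have e2 := poch_natCast_eq_multichoose (A := H + 4 * (m + 1) + p) (by omega) j
  have n1 : poch (-(H : ℂ)) p ≠ 0 := poch_neg_ne_zero (by omega)
  have n2 : poch ((H : ℂ) + 4 * ((m + 1 : ℕ) : ℂ)) p ≠ 0 :=
    poch_ne_zero_of_re_pos (by simp; positivity) p
  have n3 : poch (2 * ((m + 1 : ℕ) : ℂ) + 1) p ≠ 0 :=
    poch_ne_zero_of_re_pos (by simp; positivity) p
  have n4 : poch (2 * ((m + 1 : ℕ) : ℂ) + 1 / 2) p ≠ 0 :=
    poch_ne_zero_of_re_pos (by simp; positivity) p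
  have n5 : poch (2 * ((m + 1 : ℕ) : ℂ) + 1 + p) j ≠ 0 :=
    poch_ne_zero_of_re_pos (by simp; positivity) j
  have n6 : poch (2 * ((m + 1 : ℕ) : ℂ) + 1 / 2 + p) j ≠ 0 :=
    poch_ne_zero_of_re_pos (by simp; positivity) j
  have n7 : (p + 2 * m + 2 : ℂ) ≠ 0 := by norm_cast
  have n8 : (p + 2 * m + 3 / 2 : ℂ) ≠ 0 := by
    intro h0
    have := congrArg Complex.re h0
    simp at this
    have hp : (0 : ℝ) ≤ p := Nat.cast_nonneg p
    have hm : (0 : ℝ) ≤ m := Nat.cast_nonneg m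
    linarith
  have r1 : poch (-(H : ℂ) + p) j =
      ((H - p).choose j : ℂ) * (-1) ^ j * j.factorial := by
    rw [← e1, Nat.cast_sub (by omega)]
    congr 1
    ring
  have r2 : poch ((H : ℂ) + 4 * ((m + 1 : ℕ) : ℂ) + p) j =
      ((H + 4 * (m + 1) + p).multichoose j : ℂ) * j.factorial := by
    rw [← e2]
    push_cast
    ring_nf
  -- Each beta integral has one factor more than the step coefficient; the leading factors, here and
  -- in `r4`, are the denominator of the jump coefficient.
  have r3 : poch (2 * (m + 1) + p : ℂ) (j + 1) =
      (p + 2 * m + 2) * poch (2 * ((m + 1 : ℕ) : ℂ) + 1 + p) j := by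
    rw [poch_succ']
    push_cast
    congr 1
    · ring
    · congr 1; ring
  have r4 : poch (2 * (m + 1) - 1 / 2 + p : ℂ) (j + 1) =
      (p + 2 * m + 3 / 2) * poch (2 * ((m + 1 : ℕ) : ℂ) + 1 / 2 + p) j := by
    rw [poch_succ']
    push_cast
    congr 1
    · ring
    · congr 1; ring
  rw [r3, r4, stepCoeff, poch_add _ p j, poch_add _ p j, poch_add _ p j, poch_add _ p j,
    show h (m + 1) = H from rfl, r1, r2]
  generalize poch (-(H : ℂ)) p = P₁ at n1 ⊢
  generalize poch ((H : ℂ) + 4 * ((m + 1 : ℕ) : ℂ)) p = P₂ at n2 ⊢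
  generalize poch (2 * ((m + 1 : ℕ) : ℂ) + 1) p = P₃ at n3 ⊢
  generalize poch (2 * ((m + 1 : ℕ) : ℂ) + 1 / 2) p = P₄ at n4 ⊢
  generalize poch (2 * ((m + 1 : ℕ) : ℂ) + 1 + p) j = P₅ at n5 ⊢
  generalize poch (2 * ((m + 1 : ℕ) : ℂ) + 1 / 2 + p) j = P₆ at n6 ⊢
  field_simp

/-! ### The twisted Euler operator on polynomials -/

lemma hasDerivAt_branchPow {w₀ w : ℂ} (hw₀ : w₀ ≠ 0) (hw : w / w₀ ∈ Complex.slitPlane) (s : ℂ) :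
    HasDerivAt (branchPow w₀ s) (branchPow w₀ s w * (s / w)) w := by
  have hw0 : w ≠ 0 := by
    rintro rfl
    simp at hw
  have h1 := ((((hasDerivAt_id w).div_const w₀).clog hw).const_add (Complex.log w₀)).const_mul s
  have h2 := h1.cexp
  refine h2.congr_deriv ?_
  simp only [branchPow, id]
  field_simp

lemma eventually_div_mem_slitPlane {w₀ : ℂ} (hw₀ : w₀ ≠ 0) :
    ∀ᶠ w in 𝓝 w₀, w / w₀ ∈ Complex.slitPlane := by
  have hc : ContinuousAt (fun w : ℂ => w / w₀) w₀ := by fun_prop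
  refine hc.eventually_mem (Complex.isOpen_slitPlane.mem_nhds ?_)
  simp [hw₀]

/-- The Euler operator multiplies `w ^ (s + p)` by `s + p`. -/
lemma euler_branchPow_mul_sum {w₀ : ℂ} (hw₀ : w₀ ≠ 0) (s : ℂ) (S : Finset ℕ) (a : ℕ → ℂ)
    {g : ℂ → ℂ} (hg : g =ᶠ[𝓝 w₀] fun w => branchPow w₀ s w * ∑ p ∈ S, a p * w ^ p) :
    euler g =ᶠ[𝓝 w₀] fun w => branchPow w₀ s w * ∑ p ∈ S, ((s + p) * a p) * w ^ p := by
  filter_upwards [hg.deriv, eventually_div_mem_slitPlane hw₀] with w hd hw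
  have hw0 : w ≠ 0 := by
    rintro rfl
    simp at hw
  have h1 : HasDerivAt (fun w : ℂ => ∑ p ∈ S, a p * w ^ p)
      (∑ p ∈ S, a p * (p * w ^ (p - 1))) w :=
    HasDerivAt.fun_sum fun p _ => (hasDerivAt_pow p w).const_mul (a p)
  rw [euler, hd, ((hasDerivAt_branchPow hw₀ hw s).fun_mul h1).deriv]
  have h2 : w * ∑ p ∈ S, a p * (p * w ^ (p - 1)) = ∑ p ∈ S, (p * a p) * w ^ p := by
    rw [Finset.mul_sum]
    refine Finset.sum_congr rfl fun p _ => ?_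
    cases p with
    | zero => simp
    | succ p => simp only [Nat.add_sub_cancel, pow_succ]; ring
  have h3 : ∑ p ∈ S, ((s + p) * a p) * w ^ p =
      s * ∑ p ∈ S, a p * w ^ p + w * ∑ p ∈ S, a p * (p * w ^ (p - 1)) := by
    rw [h2, Finset.mul_sum, ← Finset.sum_add_distrib]
    exact Finset.sum_congr rfl fun p _ => by ring
  rw [h3]
  field_simp

lemma branchPow_mul (w₀ s t w : ℂ) :
    branchPow w₀ s w * branchPow w₀ t w = branchPow w₀ (s + t) w := by
  rw [branchPow, branchPow, branchPow, ← Complex.exp_add]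
  ring_nf

lemma branchPow_zero (w₀ w : ℂ) : branchPow w₀ 0 w = 1 := by simp [branchPow]

/-- The three twisting exponents add up to zero, so the chosen branch drops out; the partial sums of
exponents give the two linear factors in `p`. Working with germs at `w₀` lets the Euler operator be
applied twice, and only values of `f` away from `0` matter. -/
lemma eulerTwist_eq_sum (α : ℝ) (m : ℕ) {w₀ : ℂ} (hw₀ : w₀ ≠ 0) (S : Finset ℕ) (a : ℕ → ℂ)
    {f : ℂ → ℂ} (hf : ∀ w ≠ 0, f w = ∑ p ∈ S, a p * w ^ p) :
    eulerTwist α (m + 1) f w₀ =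
      ∑ p ∈ S, ((p + 2 * m + α / 2 + 1 / 2) * (p + 2 * m - α / 2) * a p) * w₀ ^ p := by
  have h1 : (fun w => branchPow w₀ (2 * ((m + 1 : ℕ) : ℂ) - 2 - α / 2) w * f w) =ᶠ[𝓝 w₀]
      fun w => branchPow w₀ (2 * ((m + 1 : ℕ) : ℂ) - 2 - α / 2) w * ∑ p ∈ S, a p * w ^ p := by
    filter_upwards [isOpen_ne.mem_nhds hw₀] with w hw
    rw [hf w hw]
  have h2 := euler_branchPow_mul_sum hw₀ _ S _ h1
  have h3 : (fun w => branchPow w₀ (α + 1 / 2) w *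
      euler (fun w' => branchPow w₀ (2 * ((m + 1 : ℕ) : ℂ) - 2 - α / 2) w' * f w') w) =ᶠ[𝓝 w₀]
      fun w => branchPow w₀ (α + 1 / 2 + (2 * ((m + 1 : ℕ) : ℂ) - 2 - α / 2)) w *
        ∑ p ∈ S, ((2 * ((m + 1 : ℕ) : ℂ) - 2 - α / 2 + p) * a p) * w ^ p := by
    filter_upwards [h2] with w hw
    rw [hw, ← mul_assoc, branchPow_mul]
  have h4 := (euler_branchPow_mul_sum hw₀ _ S _ h3).eq_of_nhds
  rw [eulerTwist, h4, ← mul_assoc, branchPow_mul,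
    show -(2 * ((m + 1 : ℕ) : ℂ) - 3 / 2 + α / 2) +
      (α + 1 / 2 + (2 * ((m + 1 : ℕ) : ℂ) - 2 - α / 2)) = 0 by push_cast; ring,
    branchPow_zero, one_mul]
  refine Finset.sum_congr rfl fun p _ => ?_
  push_cast
  ring

lemma eulerTwist_zero (α : ℝ) (m : ℕ) (f : ℂ → ℂ) : eulerTwist α m f 0 = 0 := by
  simp [eulerTwist, euler]

/-! ### One integral operator applied to a polynomial -/

/-- The degree bound `H ≤ h (m + 1)` makes the exponent of `(v - 1) / v` a true natural difference
after cancellation against `W ^ p`. Nonzero `w`, `t`, `u` keep `W` nonzero, where the twisted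
operator is computed. -/
lemma vIntegrand_eq_sum (α : ℝ) (h : ℕ → ℕ) (m H : ℕ) (hH : H ≤ h (m + 1)) (a : ℕ → ℂ)
    {f : ℂ → ℂ} (hf : ∀ w ≠ 0, f w = ∑ p ∈ Finset.range (H + 1), a p * w ^ p)
    {w v : ℂ} {t u : ℝ} (hw : w ≠ 0) (ht : t ≠ 0) (hu : u ≠ 0) (hv0 : v ≠ 0) (hv1 : v ≠ 1)
    (hv : 1 - w * (1 - t) * (1 - u) * v ≠ 0) :
    vIntegrand α h (m + 1) f w t u v = ∑ p ∈ Finset.range (H + 1),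
      ((p + 2 * m + α / 2 + 1 / 2) * (p + 2 * m - α / 2) * a p * (w * t * u) ^ p) *
        (v⁻¹ * ((v - 1) / v) ^ (h (m + 1) - p) *
          ((1 - w * (1 - t) * (1 - u) * v) ^ (h (m + 1) + 4 * (m + 1) + p))⁻¹) := by
  have hv1' : v - 1 ≠ 0 := sub_ne_zero.mpr hv1
  have hB : 1 - w * v * (1 - t) * (1 - u) = 1 - w * (1 - t) * (1 - u) * v := by ring
  have hx : w * t * u ≠ 0 :=
    mul_ne_zero (mul_ne_zero hw (by exact_mod_cast ht)) (by exact_mod_cast hu)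
  have hW : nextW w t u v ≠ 0 := by
    rw [nextW, hB]
    exact mul_ne_zero (div_ne_zero hv0 hv1') (div_ne_zero hx hv)
  rw [vIntegrand, eulerTwist_eq_sum α m hW _ a hf, Finset.mul_sum]
  refine Finset.sum_congr rfl fun p hp => ?_
  rw [Finset.mem_range] at hp
  obtain ⟨N, hN⟩ := Nat.exists_eq_add_of_le (show p ≤ h (m + 1) by omega)
  rw [nextW, hB, hN, Nat.add_sub_cancel_left,
    show (-(4 * ((m + 1 : ℕ) : ℤ))) = -((4 * (m + 1) : ℕ) : ℤ) by push_cast; ring,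
    zpow_neg, zpow_natCast]
  generalize 1 - w * (1 - t) * (1 - u) * v = B at hv ⊢
  generalize w * t * u = x
  generalize ((p + 2 * m + α / 2 + 1 / 2) * (p + 2 * m - α / 2) : ℂ) = d
  generalize v - 1 = y at hv1' ⊢
  have e1 : (y / v * (1 / B)) ^ (p + N) * (v / y * (x / B)) ^ p =
      x ^ p * (y / v) ^ N * ((B ^ (p + N))⁻¹ * (B ^ p)⁻¹) := by
    rw [pow_add (y / v * (1 / B)), mul_right_comm, ← mul_pow,
      show y / v * (1 / B) * (v / y * (x / B)) = x * (B⁻¹ * B⁻¹) by field_simp]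
    rw [mul_pow, mul_pow, mul_pow, one_div, inv_pow, inv_pow, pow_add B, mul_inv]
    ring
  have e2 : 1 / v * (y / v * (1 / B)) ^ (p + N) * (B ^ (4 * (m + 1)))⁻¹ *
      (d * a p * (v / y * (x / B)) ^ p) =
      v⁻¹ * d * a p * (B ^ (4 * (m + 1)))⁻¹ *
        ((y / v * (1 / B)) ^ (p + N) * (v / y * (x / B)) ^ p) := by
    rw [one_div v]
    ring
  rw [e2, e1, pow_add B (p + N + 4 * (m + 1)), pow_add B (p + N), mul_inv, mul_inv]
  ring

/-- A finite combination of beta integrands. -/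
lemma integral_sum_sum_rpow_mul (s : ℝ) (hs : 0 ≤ s) (S : Finset ℕ) (T : ℕ → Finset ℕ)
    (c : ℕ → ℕ → ℂ) {G : ℝ → ℂ}
    (hG : ∀ x ∈ Set.Ioc (0 : ℝ) 1, G x = ∑ p ∈ S, ∑ j ∈ T p,
      c p j * (((x ^ s : ℝ) : ℂ) * ((x : ℂ) ^ p * (1 - (x : ℂ)) ^ j))) :
    IntervalIntegrable G volume 0 1 ∧
      ∫ x in (0 : ℝ)..1, G x =
        ∑ p ∈ S, ∑ j ∈ T p, c p j * (j.factorial / poch (s + 1 + p) (j + 1)) := by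
  rw [← Set.uIoc_of_le (zero_le_one (α := ℝ))] at hG
  have hc := Real.continuous_rpow_const hs
  have hi : ∀ p j, Continuous fun x : ℝ =>
      c p j * (((x ^ s : ℝ) : ℂ) * ((x : ℂ) ^ p * (1 - (x : ℂ)) ^ j)) := by
    intro p j
    fun_prop
  have hsum : Continuous fun x : ℝ => ∑ p ∈ S, ∑ j ∈ T p,
      c p j * (((x ^ s : ℝ) : ℂ) * ((x : ℂ) ^ p * (1 - (x : ℂ)) ^ j)) :=
    continuous_finsetSum _ fun p _ => continuous_finsetSum _ fun j _ => hi p j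
  refine ⟨(intervalIntegrable_congr hG).mpr (hsum.intervalIntegrable 0 1), ?_⟩
  rw [intervalIntegral.integral_congr_ae (ae_of_all _ hG), intervalIntegral.integral_finsetSum
    fun p _ => (continuous_finsetSum _ fun j _ => hi p j).intervalIntegrable 0 1]
  refine Finset.sum_congr rfl fun p _ => ?_
  rw [intervalIntegral.integral_finsetSum fun j _ => (hi p j).intervalIntegrable 0 1]
  refine Finset.sum_congr rfl fun j _ => ?_
  rw [intervalIntegral.integral_const_mul, integral_rpow_mul_pow_mul_one_sub_pow s hs]

lemma vIntegrand_eqOn_sphere (α : ℝ) (h : ℕ → ℕ) (m H : ℕ) (hH : H ≤ h (m + 1)) (a : ℕ → ℂ)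
    {f : ℂ → ℂ} (hf : ∀ w ≠ 0, f w = ∑ p ∈ Finset.range (H + 1), a p * w ^ p)
    {w : ℂ} {t u r : ℝ} (hw : w ≠ 0) (ht : t ≠ 0) (hu : u ≠ 0) (hr0 : 0 < r) (hr1 : r ≠ 1)
    (hr : r * ‖w * (1 - t) * (1 - u)‖ < 1) :
    Set.EqOn (vIntegrand α h (m + 1) f w t u) (fun v => ∑ p ∈ Finset.range (H + 1),
      ((p + 2 * m + α / 2 + 1 / 2) * (p + 2 * m - α / 2) * a p * (w * t * u) ^ p) *
        (v⁻¹ * ((v - 1) / v) ^ (h (m + 1) - p) *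
          ((1 - w * (1 - t) * (1 - u) * v) ^ (h (m + 1) + 4 * (m + 1) + p))⁻¹))
      (Metric.sphere 0 r) := by
  intro v hv
  rw [mem_sphere_zero_iff_norm] at hv
  refine vIntegrand_eq_sum α h m H hH a hf hw ht hu ?_ ?_ (one_sub_mul_ne_zero hr hv.le)
  · exact norm_ne_zero_iff.mp (by rw [hv]; exact hr0.ne')
  · rintro rfl
    exact hr1 (by rw [← hv, norm_one])

lemma circleIntegrable_mul_div_pow_mul_inv_pow {b : ℂ} {r : ℝ} (hr0 : 0 < r)
    (hr : r * ‖b‖ < 1) (c : ℂ) (N A : ℕ) :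
    CircleIntegrable (fun v : ℂ => c * (v⁻¹ * ((v - 1) / v) ^ N * ((1 - b * v) ^ A)⁻¹)) 0 r := by
  refine ContinuousOn.circleIntegrable hr0.le fun v hv => ContinuousAt.continuousWithinAt ?_
  rw [mem_sphere_zero_iff_norm] at hv
  have h0 : v ≠ 0 := norm_ne_zero_iff.mp (by rw [hv]; exact hr0.ne')
  have h1 := pow_ne_zero A (one_sub_mul_ne_zero hr hv.le)
  fun_prop (disch := assumption)

lemma circleIntegrable_vIntegrand (α : ℝ) (h : ℕ → ℕ) (m H : ℕ) (hH : H ≤ h (m + 1)) (a : ℕ → ℂ)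
    {f : ℂ → ℂ} (hf : ∀ w ≠ 0, f w = ∑ p ∈ Finset.range (H + 1), a p * w ^ p)
    {w : ℂ} {t u r : ℝ} (hw : w ≠ 0) (ht : t ≠ 0) (hu : u ≠ 0) (hr0 : 0 < r) (hr1 : r ≠ 1)
    (hr : r * ‖w * (1 - t) * (1 - u)‖ < 1) :
    CircleIntegrable (vIntegrand α h (m + 1) f w t u) 0 r := by
  have h1 := vIntegrand_eqOn_sphere α h m H hH a hf hw ht hu hr0 hr1 hr
  have h2 : CircleIntegrable (fun v => ∑ p ∈ Finset.range (H + 1),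
      ((p + 2 * m + α / 2 + 1 / 2) * (p + 2 * m - α / 2) * a p * (w * t * u) ^ p) *
        (v⁻¹ * ((v - 1) / v) ^ (h (m + 1) - p) *
          ((1 - w * (1 - t) * (1 - u) * v) ^ (h (m + 1) + 4 * (m + 1) + p))⁻¹)) 0 r :=
    CircleIntegrable.fun_sum _ fun p _ => circleIntegrable_mul_div_pow_mul_inv_pow hr0 hr _ _ _
  refine h2.congr fun θ _ => ?_
  exact (h1 (circleMap_mem_sphere 0 hr0.le θ)).symm

lemma uIntegrand_eq_sum (α : ℝ) (h : ℕ → ℕ) (R : ℕ → ℂ → ℝ → ℝ → ℝ) (hR : AdmissibleRadii R)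
    (m H : ℕ) (hH : H ≤ h (m + 1)) (a : ℕ → ℂ) {f : ℂ → ℂ}
    (hf : ∀ w ≠ 0, f w = ∑ p ∈ Finset.range (H + 1), a p * w ^ p)
    {w : ℂ} {t u : ℝ} (hw : w ≠ 0) (ht : t ∈ Set.Ioc (0 : ℝ) 1) (hu : u ∈ Set.Ioc (0 : ℝ) 1) :
    uIntegrand α h R (m + 1) f w t u =
      ∑ p ∈ Finset.range (H + 1), ∑ j ∈ Finset.range (h (m + 1) - p + 1),
        ((p + 2 * m + α / 2 + 1 / 2) * (p + 2 * m - α / 2) * a p *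
          ((h (m + 1) - p).choose j * (-1) ^ j *
            (h (m + 1) + 4 * (m + 1) + p).multichoose j) * w ^ (p + j) *
          (t ^ p * (1 - t) ^ j)) *
        (((u ^ (2 * ((m + 1 : ℕ) : ℝ) - 3 / 2) : ℝ) : ℂ) * ((u : ℂ) ^ p * (1 - (u : ℂ)) ^ j)) := by
  obtain ⟨hr0, hr1, hr⟩ := hR (m + 1) w t ⟨ht.1.le, ht.2⟩ u ⟨hu.1.le, hu.2⟩
  have hpi : (2 * Real.pi * Complex.I : ℂ) ≠ 0 := Complex.two_pi_I_ne_zero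
  rw [uIntegrand, circleIntegral.integral_congr hr0.le
      (vIntegrand_eqOn_sphere α h m H hH a hf hw ht.1.ne' hu.1.ne' hr0 hr1 hr),
    circleIntegral.integral_fun_sum fun p _ =>
      circleIntegrable_mul_div_pow_mul_inv_pow hr0 hr _ _ _, Finset.mul_sum, Finset.mul_sum]
  refine Finset.sum_congr rfl fun p _ => ?_
  rw [circleIntegral.integral_const_mul, circleIntegral_div_pow_mul_inv_pow hr0 hr,
    mul_left_comm _ (2 * Real.pi * Complex.I : ℂ), ← mul_assoc (1 / _), one_div_mul_cancel hpi,
    one_mul, Finset.mul_sum, Finset.mul_sum]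
  refine Finset.sum_congr rfl fun j _ => ?_
  rw [mul_pow, mul_pow, mul_pow, mul_pow, pow_add]
  ring

/-- After the residue, the `u` and `t` integrands are finite combinations of continuous beta
integrands, which gives integrability and values together. The index `j` of the residue is the
increment `i - p` of the appended sum. -/
lemma integrals_of_eq_sum (α : ℝ) (h : ℕ → ℕ) (R : ℕ → ℂ → ℝ → ℝ → ℝ) (hR : AdmissibleRadii R)
    (m H : ℕ) (hH : H ≤ h (m + 1)) (a : ℕ → ℂ) {f : ℂ → ℂ}
    (hf : ∀ w ≠ 0, f w = ∑ p ∈ Finset.range (H + 1), a p * w ^ p) {w : ℂ} (hw : w ≠ 0) :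
    (∀ t ∈ Set.Ioc (0 : ℝ) 1,
      IntervalIntegrable (uIntegrand α h R (m + 1) f w t) volume 0 1) ∧
    IntervalIntegrable (tIntegrand α h R (m + 1) f w) volume 0 1 ∧
    integralOp α h R (m + 1) f w =
      ∑ p ∈ Finset.range (H + 1), a p * (jumpCoeff α m p * nestedSum α h w 0 (m + 1) p) := by
  have hm : (0 : ℝ) ≤ m := Nat.cast_nonneg m
  have hsu : (0 : ℝ) ≤ 2 * ((m + 1 : ℕ) : ℝ) - 3 / 2 := by push_cast; linarith
  have hst : (0 : ℝ) ≤ 2 * ((m + 1 : ℕ) : ℝ) - 1 := by push_cast; linarith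
  have hU := fun t ht => integral_sum_sum_rpow_mul _ hsu _ _ _
    (fun u hu => uIntegrand_eq_sum α h R hR m H hH a hf hw (t := t) ht hu)
  have hT := integral_sum_sum_rpow_mul _ hst (Finset.range (H + 1))
    (fun p => Finset.range (h (m + 1) - p + 1))
    (fun p j => (p + 2 * m + α / 2 + 1 / 2) * (p + 2 * m - α / 2) * a p *
          ((h (m + 1) - p).choose j * (-1) ^ j *
            (h (m + 1) + 4 * (m + 1) + p).multichoose j) * w ^ (p + j) *
          (j.factorial / poch (((2 * ((m + 1 : ℕ) : ℝ) - 3 / 2 : ℝ) : ℂ) + 1 + p) (j + 1)))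
    (G := tIntegrand α h R (m + 1) f w) (fun t ht => by
      rw [tIntegrand, (hU t ht).2, Finset.mul_sum]
      refine Finset.sum_congr rfl fun p _ => ?_
      rw [Finset.mul_sum]
      exact Finset.sum_congr rfl fun j _ => by ring)
  refine ⟨fun t ht => (hU t ht).1, hT.1, ?_⟩
  rw [integralOp, hT.2]
  refine Finset.sum_congr rfl fun p hp => ?_
  rw [Finset.mem_range] at hp
  rw [nestedSum, ← Finset.Ico_add_one_right_eq_Icc, Finset.sum_Ico_eq_sum_range,
    Nat.sub_add_comm (by omega : p ≤ h (m + 1)), Finset.mul_sum, Finset.mul_sum]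
  refine Finset.sum_congr rfl fun j hj => ?_
  rw [Finset.mem_range] at hj
  have key := stepCoeff_succ_add h m p j (by omega)
  have e1 : ((2 * ((m + 1 : ℕ) : ℝ) - 3 / 2 : ℝ) : ℂ) + 1 + p = 2 * (m + 1) - 1 / 2 + p := by
    push_cast
    ring
  have e2 : ((2 * ((m + 1 : ℕ) : ℝ) - 1 : ℝ) : ℂ) + 1 + p = 2 * (m + 1) + p := by
    push_cast
    ring
  rw [e1, e2, jumpCoeff]
  linear_combination
    ((p + 2 * m + α / 2 + 1 / 2) * (p + 2 * m - α / 2) * a p * w ^ (p + j) : ℂ) * key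

/-! ### Nested sums and the induction on `n` -/

/-- The nested sums recurse from the outermost index, whereas the integral operators append an
innermost one. Using the same coefficients `c`, independent of `η`, in both identities lets the
recursion be unfolded from the inner end. -/
lemma exists_nestedSum_eq_sum (α : ℝ) (h : ℕ → ℕ) (r k p : ℕ) :
    ∃ c : ℕ → ℂ, ∀ η,
      nestedSum α h η r k p = ∑ q ∈ Finset.range (h (k + r) + 1), c q * η ^ q ∧
      nestedSum α h η (r + 1) k p = ∑ q ∈ Finset.range (h (k + r) + 1),
        c q * (jumpCoeff α (k + r) q * nestedSum α h η 0 (k + r + 1) q) := by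
  induction r generalizing k p with
  | zero =>
    have hI : ∀ g : ℕ → ℂ, ∑ i ∈ Finset.Icc p (h k), g i =
        ∑ i ∈ Finset.range (h k + 1), if p ≤ i then g i else 0 := by
      intro g
      rw [← Finset.sum_filter]
      refine Finset.sum_congr ?_ fun _ _ => rfl
      ext i
      simp only [Finset.mem_Icc, Finset.mem_filter, Finset.mem_range]
      omega
    refine ⟨fun q => if p ≤ q then stepCoeff h k p q else 0, fun η => ⟨?_, ?_⟩⟩
    · rw [nestedSum, hI]
      exact Finset.sum_congr rfl fun q _ => by rw [ite_mul, zero_mul]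
    · rw [nestedSum, hI]
      refine Finset.sum_congr rfl fun q _ => ?_
      rw [ite_mul, zero_mul, add_zero]
      congr 1
      ring
  | succ r ih =>
    choose c hc using ih
    refine ⟨fun q => ∑ i ∈ Finset.Icc p (h k),
      jumpCoeff α k i * stepCoeff h k p i * c (k + 1) i q, fun η => ⟨?_, ?_⟩⟩
    · simp only [Finset.sum_mul]
      rw [nestedSum, Finset.sum_comm]
      refine Finset.sum_congr rfl fun i _ => ?_
      rw [(hc (k + 1) i η).1, Finset.mul_sum, show k + 1 + r = k + (r + 1) by omega]
      exact Finset.sum_congr rfl fun q _ => by ring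
    · simp only [Finset.sum_mul]
      rw [nestedSum, Finset.sum_comm]
      refine Finset.sum_congr rfl fun i _ => ?_
      rw [(hc (k + 1) i η).2, Finset.mul_sum, show k + 1 + r = k + (r + 1) by omega]
      exact Finset.sum_congr rfl fun q _ => by ring

lemma ordinaryHypergeometric_neg_natCast_eq_sum (N : ℕ) (b c w : ℂ) :
    ordinaryHypergeometric (-(N : ℂ)) b c w =
      ∑ i ∈ Finset.range (N + 1), poch (-(N : ℂ)) i * poch b i / (poch 1 i * poch c i) * w ^ i := by
  rw [ordinaryHypergeometric_eq_tsum]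
  dsimp only
  rw [tsum_eq_sum (s := Finset.range (N + 1))]
  · refine Finset.sum_congr rfl fun i _ => ?_
    rw [Nat.cast_factorial, smul_eq_mul]
    simp only [poch, div_eq_mul_inv, mul_inv]
    ring
  · intro i hi
    rw [Finset.mem_range, not_lt] at hi
    rw [ascPochhammer_eval_neg_coe_nat_of_lt (by omega)]
    simp

lemma seriesCoeff_zero (α : ℝ) (h : ℕ → ℕ) (η : ℂ) :
    seriesCoeff α h 0 η = ordinaryHypergeometric (-(h 0 : ℂ)) (h 0 : ℂ) (1 / 2 : ℂ) η := by
  rw [ordinaryHypergeometric_neg_natCast_eq_sum, seriesCoeff, nestedSum,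
    ← Finset.Ico_add_one_right_eq_Icc, ← Finset.range_eq_Ico]
  refine Finset.sum_congr rfl fun i _ => ?_
  simp [stepCoeff, poch_zero]

lemma iteratedIntegral_eq_seriesCoeff (α : ℝ) (h : ℕ → ℕ) (hh : Monotone h)
    (R : ℕ → ℂ → ℝ → ℝ → ℝ) (hR : AdmissibleRadii R) (n : ℕ) {w : ℂ} (hw : w ≠ 0) :
    iteratedIntegral α h R n w = seriesCoeff α h n w := by
  induction n generalizing w with
  | zero => exact (seriesCoeff_zero α h w).symm
  | succ n ih =>
    obtain ⟨c, hc⟩ := exists_nestedSum_eq_sum α h n 0 0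
    simp only [Nat.zero_add] at hc
    rw [iteratedIntegral, (integrals_of_eq_sum α h R hR n (h n) (hh n.le_succ) c
      (fun x hx => (ih hx).trans (hc x).1) hw).2.2, seriesCoeff, (hc w).2]

/-! ### The degenerate argument `w = 0` -/

/-- At `w = 0` every `W` is `0`, and the outer Euler operator carries the factor `w₀ = 0`. -/
lemma vIntegrand_zero (α : ℝ) (h : ℕ → ℕ) (m : ℕ) (f : ℂ → ℂ) (t u : ℝ) :
    vIntegrand α h m f 0 t u = 0 := by
  ext v
  simp [vIntegrand, nextW, eulerTwist_zero]

lemma uIntegrand_zero (α : ℝ) (h : ℕ → ℕ) (R : ℕ → ℂ → ℝ → ℝ → ℝ) (m : ℕ) (f : ℂ → ℂ) (t : ℝ) :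
    uIntegrand α h R m f 0 t = 0 := by
  ext u
  simp [uIntegrand, vIntegrand_zero, circleIntegral]

lemma tIntegrand_zero (α : ℝ) (h : ℕ → ℕ) (R : ℕ → ℂ → ℝ → ℝ → ℝ) (m : ℕ) (f : ℂ → ℂ) :
    tIntegrand α h R m f 0 = 0 := by
  ext t
  simp [tIntegrand, uIntegrand_zero]

end Lame

theorem mainTheorem5 (ρ α : ℝ) (hρ0 : 0 < ρ) (hρ1 : ρ < 1) (h : ℕ → ℕ) (hh : Monotone h)
    (R : ℕ → ℂ → ℝ → ℝ → ℝ) (hR : Lame.AdmissibleRadii R) (ξ : ℂ) :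
    -- all the integrals converge absolutely
    (∀ (m : ℕ) (w : ℂ),
      (∀ t ∈ Set.Ioc (0 : ℝ) 1, ∀ u ∈ Set.Ioc (0 : ℝ) 1,
        CircleIntegrable
          (Lame.vIntegrand α h (m + 1) (Lame.iteratedIntegral α h R m) w t u)
          0 (R (m + 1) w t u)) ∧
      (∀ t ∈ Set.Ioc (0 : ℝ) 1,
        IntervalIntegrable
          (Lame.uIntegrand α h R (m + 1) (Lame.iteratedIntegral α h R m) w t)
          MeasureTheory.volume 0 1) ∧
      IntervalIntegrable
        (Lame.tIntegrand α h R (m + 1) (Lame.iteratedIntegral α h R m) w)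
        MeasureTheory.volume 0 1) ∧
    -- the two expansions agree term by term
    Lame.seriesCoeff α h 0 (Lame.etaVar ρ ξ) =
      ordinaryHypergeometric (-(h 0 : ℂ)) (h 0 : ℂ) (1 / 2 : ℂ) (Lame.etaVar ρ ξ) ∧
    (∀ n : ℕ, 1 ≤ n →
      Lame.seriesCoeff α h n (Lame.etaVar ρ ξ) * Lame.zVar ρ ξ ^ n =
        Lame.iteratedIntegral α h R n (Lame.etaVar ρ ξ) * Lame.zVar ρ ξ ^ n) ∧
    -- the integral representation of the function
    (∀ y : ℂ, Lame.IsLF ρ α h ξ y ↔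
      Filter.Tendsto (fun N : ℕ =>
          ordinaryHypergeometric (-(h 0 : ℂ)) (h 0 : ℂ) (1 / 2 : ℂ) (Lame.etaVar ρ ξ) +
            ∑ n ∈ Finset.Icc 1 N,
              Lame.iteratedIntegral α h R n (Lame.etaVar ρ ξ) * Lame.zVar ρ ξ ^ n)
        Filter.atTop (nhds y)) := by
  have hterm : ∀ n : ℕ, 1 ≤ n →
      Lame.seriesCoeff α h n (Lame.etaVar ρ ξ) * Lame.zVar ρ ξ ^ n =
        Lame.iteratedIntegral α h R n (Lame.etaVar ρ ξ) * Lame.zVar ρ ξ ^ n := by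
    intro n hn
    by_cases hξ : ξ = 0
    -- The coefficients themselves need not agree at `η = 0`; the factor `z ^ n` with `n ≥ 1` makes
    -- both sides vanish.
    · have hz : Lame.zVar ρ ξ = 0 := by simp [Lame.zVar, hξ]
      rw [hz, zero_pow (by omega), mul_zero, mul_zero]
    · have hρ : (1 + (ρ : ℂ) ^ 2) ≠ 0 := by
        have : (1 + ρ ^ 2 : ℝ) ≠ 0 := by positivity
        exact_mod_cast this
      have hη : Lame.etaVar ρ ξ ≠ 0 := mul_ne_zero hρ hξ
      rw [Lame.iteratedIntegral_eq_seriesCoeff α h hh R hR n hη]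
  refine ⟨fun m w => ?_, Lame.seriesCoeff_zero α h _, hterm, fun y => ?_⟩
  · by_cases hw : w = 0
    · subst hw
      rw [Lame.tIntegrand_zero]
      refine ⟨fun t _ u _ => ?_, fun t _ => ?_, intervalIntegrable_const⟩
      · rw [Lame.vIntegrand_zero]
        exact circleIntegrable_const 0 _ _
      · rw [Lame.uIntegrand_zero]
        exact intervalIntegrable_const
    · obtain ⟨c, hc⟩ := Lame.exists_nestedSum_eq_sum α h m 0 0
      simp only [Nat.zero_add] at hc
      have hf : ∀ x ≠ 0, Lame.iteratedIntegral α h R m x =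
          ∑ p ∈ Finset.range (h m + 1), c p * x ^ p := fun x hx =>
        (Lame.iteratedIntegral_eq_seriesCoeff α h hh R hR m hx).trans (hc x).1
      obtain ⟨hU, hT, -⟩ :=
        Lame.integrals_of_eq_sum α h R hR m (h m) (hh m.le_succ) c hf hw
      refine ⟨fun t ht u hu => ?_, hU, hT⟩
      obtain ⟨hr0, hr1, hr⟩ := hR (m + 1) w t ⟨ht.1.le, ht.2⟩ u ⟨hu.1.le, hu.2⟩
      exact Lame.circleIntegrable_vIntegrand α h m (h m) (hh m.le_succ) c hf hw ht.1.ne' hu.1.ne'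
        hr0 hr1 hr
  · rw [Lame.IsLF]
    refine iff_of_eq (congrArg (Filter.Tendsto · _ _) (funext fun N => ?_))
    rw [Finset.range_eq_Ico, Finset.sum_eq_sum_Ico_succ_bot (by omega), pow_zero, mul_one,
      Lame.seriesCoeff_zero, zero_add, Finset.Ico_add_one_right_eq_Icc]
    congr 1
    exact Finset.sum_congr rfl fun n hn => hterm n (Finset.mem_Icc.mp hn).1
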